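/- **Setting.** Let $n,p\ge 0$, $H\ge 1$, $f:\mathbb R^n\times\mathbb R^p\to\mathbb R^n$, $\ell:\mathbb R^n\times\mathbb R^p\to\mathbb R$, $\ell_H:\mathbb R^n\to\mathbb R$. For a state $x$ consider the problem $$\min_{\bar x\in\mathbb R^{n(H+1)},\,\bar u\in\mathbb R^{pH}}\ J(\bar x,\bar u)=\sum_{i=1}^{H}\ell(\bar x_i,\bar u_i)+\ell_H(\bar x_{H+1})\quad\text{s.t. } \bar x_1=x,\ \ \bar x_{i+1}=f(\bar x_i,\bar u_i)\ (1\le i\le H),$$ with Lagrangian $\mathcal L(x,z)=J(\bar x,\bar u)+\lambda_1^\top(\bar x_1-x)+\sum_{i=2}^{H+1}\lambda_i^\top(\bar x_i-f(\bar x_{i-1},\bar u_{i-1}))$, $z=(\bar x,\bar u,\lambda)$. For every $x$ let $z^\star(x)=(\bar x^\star,\bar u^\star,\lambda^\star)(x)$ be a solution (global minimizer with multipliers), so $\nabla_z\mathcal L(x,z^\star(x))=0$. Put $\kappa_{MPC}(x)=\bar u_1^\star(x)$, $f_{MPC}(x)=f(x,\kappa_{MPC}(x))$ (nominal map) and $\tilde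 f(x,d)=f(x,\kappa_{MPC}(x)-d)$ (perturbed map). Fix a number $N$ of correction steps and a sampling time $T_s>0$. A *PC-MPC run* is a sequence $(x(k),z_k)_{k\ge0}$, with arbitrary $x(0),z_0$, such that $x(k+1)=f(x(k),u(k))$, $u(k)$ being the first input $\bar u_1$ of $z_k$, and $z_{k+1}$ is obtained from the prediction $z_k-\nabla^2_{zz}\mathcal L(x(k),z_k)^{-1}\nabla^2_{zx}\mathcal L(x(k),z_k)(x(k+1)-x(k))$ by $N$ Newton steps $z\mapsto z-\nabla^2_{zz}\mathcal L(x(k+1),z)^{-1}\nabla_z\mathcal L(x(k+1),z)$. Its solution error is $d(k)=\kappa_{MPC}(x(k))-u(k)$, so that $x(k+1)=\tilde f(x(k),d(k))$. **Assumptions.** 1. $f,\ell,\ell_H$ are continuous, $\ell,\ell_H\ge0$, and $f(0,0)=0$, $\ell(0,0)=0$, $\ell_H(0)=0$. 2. (On a trajectory $x(\cdot)$, for given compact sets $\mathcal X\subset\mathbb R^{n(H+1)}$, $\mathcal U\subset\mathbb R^{pH}$.) $(\bar x^\star,\bar u^\star)(x(k))\in\mathcal X\times\mathcal U$ for all $k\ge0$.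 3. $\ell(x,u)\ge\alpha_1(\|x\|)$ and $\ell_H(x)\le\alpha_2(\|x\|)$ with $\alpha_1,\alpha_2\in\mathcal K_\infty$, and for every $x$ there is $u$ with $\ell_H(f(x,u))+\ell(x,u)\le\ell_H(x)$. 4. (On a PC-MPC run.) There is $B>0$ with $\|x(k+1)-x(k)\|\le BT_s$ for all $k\ge 0$. 5. There is $m>0$ such that for all $x$ every eigenvalue of $\nabla^2_{zz}\mathcal L(x,z^\star(x))$ has absolute value $>2m$. 6. $\mathcal L$ is $C^2$, $\|\nabla^2_{zx}\mathcal L(x,z)\|\le C$ for all $x,z$, and $[\nabla^2_{zz}\mathcal L,\nabla^2_{zx}\mathcal L]$ is $L$-Lipschitz in $(x,z)$ for some $L>0$. A family of pairs (trajectory $x(\cdot)$, disturbance sequence $d(\cdot)$) is *input-to-state stable (ISS)* if there are $\beta\in\mathcal{KL}$ and $\gamma\in\mathcal K$ such that every pair in it satisfies $$\|x(k)\|\le\beta(\|x(0)\|,k)+\gamma\big(\max_{j<k}\|d(j)\|\big)\qquad\text{for all }k\ge0,$$ and *locally ISS* if there are $c_1,c_2>0$ such that its pairs with $\|x(0)\|\le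 c_1$ and $\|d(k)\|\le c_2$ for all $k$ form an ISS family. **Proposition.** Let Assumptions 1, 3, 5, 6 hold. (a) Suppose that for every $x$ the map $d\mapsto\tilde f(x,d)$ is uniformly continuous on bounded sets, and that $f_{MPC}$ is uniformly continuous on bounded sets (in particular, if these maps are absolutely continuous). Then, for all compact $\mathcal X,\mathcal U$, the system $x(k+1)=\tilde f(x(k),d(k))$ is ISS: the family of all its trajectories satisfying Assumption 2, with arbitrary $x(0)\in\mathbb R^n$ and arbitrary disturbances $d(\cdot)$, is ISS. In particular, for every $N$, the PC-MPC closed loop is ISS with respect to the solution error $d(k)$, i.e. the family of its runs satisfying Assumptions 2 and 4 is ISS. (b) Suppose that $\tilde f$ is continuous in a neighborhood of $(0,0)$ and $f_{MPC}$ is continuous in a neighborhood of $0$. Then the system $x(k+1)=\tilde f(x(k),d(k))$ is locally ISS and, for every $N$, so is the PC-MPC closed loop (runs satisfying Assumption 4) with respect to $d(k)$; Assumption 2 is not needed here. -/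

import Mathlib

open scoped NNReal Topology InnerProductSpace

noncomputable section

namespace PCMPC

/-! Comparison functions on `[0, ∞)`. -/

/-- Class `K`: continuous, strictly increasing, zero at zero. -/
def IsClassK (γ : ℝ≥0 → ℝ≥0) : Prop :=
  Continuous γ ∧ StrictMono γ ∧ γ 0 = 0

/-- Class `K∞`: class `K` and unbounded. -/
def IsClassKInf (γ : ℝ≥0 → ℝ≥0) : Prop :=
  IsClassK γ ∧ Filter.Tendsto γ Filter.atTop Filter.atTop

/-- Class `KL` in discrete time: class `K` in the first argument, nonincreasing to zero in
the second one. -/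
def IsClassKL (β : ℝ≥0 → ℕ → ℝ≥0) : Prop :=
  (∀ k, IsClassK fun s => β s k) ∧
    ∀ s, Antitone (β s) ∧ Filter.Tendsto (β s) Filter.atTop (𝓝 0)

/-! Input-to-state stability of a set of (state sequence, disturbance sequence) pairs. -/

section ISS

variable {X W : Type*} [NormedAddCommGroup X] [NormedAddCommGroup W]

/-- The trajectories of `x (k + 1) = g (x k) (d k)`. -/
def Trajectories (g : X → W → X) : Set ((ℕ → X) × (ℕ → W)) :=
  {τ | ∀ k, τ.1 (k + 1) = g (τ.1 k) (τ.2 k)}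

/-- The estimate `‖x k‖ ≤ β (‖x 0‖, k) + γ (max_{j < k} ‖d j‖)` for all `k`
(the maximum over the empty set is zero). -/
def ISSEstimate (β : ℝ≥0 → ℕ → ℝ≥0) (γ : ℝ≥0 → ℝ≥0) (x : ℕ → X) (d : ℕ → W) : Prop :=
  ∀ k, ‖x k‖₊ ≤ β ‖x 0‖₊ k + γ ((Finset.range k).sup fun j => ‖d j‖₊)

/-- Input-to-state stability, with one `β` and one `γ` for all trajectories in `T`. -/
def IsISS (T : Set ((ℕ → X) × (ℕ → W))) : Prop :=
  ∃ (β : ℝ≥0 → ℕ → ℝ≥0) (γ : ℝ≥0 → ℝ≥0), IsClassKL β ∧ IsClassK γ ∧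
    ∀ τ ∈ T, ISSEstimate β γ τ.1 τ.2

/-- Local input-to-state stability: the estimate holds for small initial states and small
disturbances. -/
def IsLocallyISS (T : Set ((ℕ → X) × (ℕ → W))) : Prop :=
  ∃ c₁ : ℝ, 0 < c₁ ∧ ∃ c₂ : ℝ, 0 < c₂ ∧
    IsISS {τ ∈ T | ‖τ.1 0‖ ≤ c₁ ∧ ∀ k, ‖τ.2 k‖ ≤ c₂}

end ISS

/-! The receding horizon problem. -/

abbrev State (n : ℕ) := EuclideanSpace ℝ (Fin n)

abbrev Input (p : ℕ) := EuclideanSpace ℝ (Fin p)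

/-- Stacked predicted states `(x̄₁, …, x̄_{H+1})` (indexed from `0` to `H`), Euclidean norm. -/
abbrev StateSeq (n H : ℕ) := PiLp 2 fun _ : Fin (H + 1) => State n

/-- Stacked predicted inputs `(ū₁, …, ū_H)` (indexed from `0` to `H - 1`), Euclidean norm. -/
abbrev InputSeq (p H : ℕ) := PiLp 2 fun _ : Fin H => Input p

/-- The stacked variable `z = (x̄, ū, λ)` with the Euclidean norm. -/
abbrev Var (n p H : ℕ) := WithLp 2 (StateSeq n H × WithLp 2 (InputSeq p H × StateSeq n H))

/-- The pair `(x, z)` with the Euclidean norm. -/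
abbrev Param (n p H : ℕ) := WithLp 2 (State n × Var n p H)

/-- The predicted states `x̄` in `z`. -/
def states {n p H : ℕ} (z : Var n p H) : StateSeq n H := z.fst

/-- The predicted inputs `ū` in `z`. -/
def inputs {n p H : ℕ} (z : Var n p H) : InputSeq p H := z.snd.fst

/-- The multipliers `λ` in `z`. -/
def multipliers {n p H : ℕ} (z : Var n p H) : StateSeq n H := z.snd.snd

/-- The first predicted input `ū₁` in `z`. -/
def firstInput {n p H : ℕ} [NeZero H] (z : Var n p H) : Input p := inputs z 0

/-- Dynamics, stage cost and terminal cost. -/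
structure System (n p : ℕ) where
  f : State n → Input p → State n
  stage : State n → Input p → ℝ
  terminal : State n → ℝ

namespace System

variable {n p : ℕ} (S : System n p) {H : ℕ}

/-- The cost `J` over the horizon `H`. -/
def cost (xs : StateSeq n H) (us : InputSeq p H) : ℝ :=
  (∑ i : Fin H, S.stage (xs i.castSucc) (us i)) + S.terminal (xs (Fin.last H))

/-- The constraints of the receding horizon problem at the state `x`. -/
def Feasible (x : State n) (xs : StateSeq n H) (us : InputSeq p H) : Prop :=
  xs 0 = x ∧ ∀ i : Fin H, xs i.succ = S.f (xs i.castSucc) (us i)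

/-- `(xs, us)` is a (global) minimizer of the receding horizon problem at `x`. -/
def IsOptimal (x : State n) (xs : StateSeq n H) (us : InputSeq p H) : Prop :=
  S.Feasible x xs us ∧ ∀ (xs' : StateSeq n H) (us' : InputSeq p H),
    S.Feasible x xs' us' → S.cost xs us ≤ S.cost xs' us'

/-- The Lagrangian `ℒ(x, z)` of the receding horizon problem. -/
def lagrangian (x : State n) (z : Var n p H) : ℝ :=
  S.cost (states z) (inputs z) + ⟪multipliers z 0, states z 0 - x⟫_ℝ +
    ∑ i : Fin H, ⟪multipliers z i.succ,
      states z i.succ - S.f (states z i.castSucc) (inputs z i)⟫_ℝ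

/-- `∇_z ℒ(x, z)`. -/
def grad (x : State n) (z : Var n p H) : Var n p H :=
  gradient (fun z => S.lagrangian x z) z

/-- `∇²_zz ℒ(x, z)`. -/
def hessZZ (x : State n) (z : Var n p H) : Var n p H →L[ℝ] Var n p H :=
  fderiv ℝ (fun z => S.grad x z) z

/-- `∇²_zx ℒ(x, z)`. -/
def hessZX (x : State n) (z : Var n p H) : State n →L[ℝ] Var n p H :=
  fderiv ℝ (fun x => S.grad x z) x

/-- `D(x, z) = [∇²_zz ℒ(x, z), ∇²_zx ℒ(x, z)]`, the derivative of `∇_z ℒ` in `(x, z)`. -/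
def gradDeriv (y : Param n p H) : Param n p H →L[ℝ] Var n p H :=
  fderiv ℝ (fun y : Param n p H => S.grad y.fst y.snd) y

/-- `zstar x` is a solution of the receding horizon problem at `x`, together with multipliers
for which the first order condition holds. -/
def IsSolutionMap (zstar : State n → Var n p H) : Prop :=
  ∀ x, S.IsOptimal x (states (zstar x)) (inputs (zstar x)) ∧ S.grad x (zstar x) = 0

/-! The standing assumptions. -/

/-- Continuity of system and cost; the costs are nonnegative and everything vanishes at the
origin. -/
def ContinuityAssumption : Prop :=
  Continuous (fun q : State n × Input p => S.f q.1 q.2) ∧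
  Continuous (fun q : State n × Input p => S.stage q.1 q.2) ∧
  Continuous S.terminal ∧
  (∀ x u, 0 ≤ S.stage x u) ∧ (∀ x, 0 ≤ S.terminal x) ∧
  S.f 0 0 = 0 ∧ S.stage 0 0 = 0 ∧ S.terminal 0 = 0

/-- Bounds on stage and terminal cost, and
`min_u {ℓ_H(f(x, u)) + ℓ(x, u)} ≤ ℓ_H(x)` for all `x`. -/
def CostAssumption : Prop :=
  (∃ α₁ α₂ : ℝ≥0 → ℝ≥0, IsClassKInf α₁ ∧ IsClassKInf α₂ ∧
    (∀ x u, (α₁ ‖x‖₊ : ℝ) ≤ S.stage x u) ∧ ∀ x, S.terminal x ≤ α₂ ‖x‖₊) ∧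
  ∀ x, ∃ u, S.terminal (S.f x u) + S.stage x u ≤ S.terminal x

/-- All eigenvalues of `∇²_zz ℒ(x, z⋆(x))` have absolute value above `2 m`, for all `x`. -/
def EigenvalueAssumption (zstar : State n → Var n p H) (m : ℝ) : Prop :=
  0 < m ∧ ∀ (x : State n) (μ : ℝ),
    Module.End.HasEigenvalue (S.hessZZ x (zstar x) : Var n p H →ₗ[ℝ] Var n p H) μ → 2 * m < |μ|

variable (H) in
/-- Smoothness of the Lagrangian for the horizon `H`: bounded `∇²_zx ℒ`, and `L`-Lipschitz
derivative of `∇_z ℒ`. -/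
def SmoothnessAssumption (C L : ℝ) : Prop :=
  ContDiff ℝ 2 (fun y : Param n p H => S.lagrangian y.fst y.snd) ∧
  (∀ (x : State n) (z : Var n p H), ‖S.hessZX x z‖ ≤ C) ∧
  0 < L ∧ ∀ y₁ y₂ : Param n p H, ‖S.gradDeriv y₁ - S.gradDeriv y₂‖ ≤ L * ‖y₁ - y₂‖

/-! The control laws. -/

/-- Prediction step from `(x, z)` when the next state is `x'`. -/
def predict (x x' : State n) (z : Var n p H) : Var n p H :=
  z - (S.hessZZ x z).inverse (S.hessZX x z (x' - x))

/-- Correction (Newton) step at the state `x`. -/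
def correct (x : State n) (z : Var n p H) : Var n p H :=
  z - (S.hessZZ x z).inverse (S.grad x z)

variable [NeZero H]

/-- The nominal closed loop `f_MPC(x) = f(x, κ_MPC(x))`, `κ_MPC(x)` being the first input of
the solution at `x`. -/
def nominal (zstar : State n → Var n p H) (x : State n) : State n :=
  S.f x (firstInput (zstar x))

/-- The perturbed closed loop `f̃(x, d)`: as `d = u_MPC - u`, the applied input is
`κ_MPC(x) - d`. -/
def perturbed (zstar : State n → Var n p H) (x : State n) (d : Input p) : State n :=
  S.f x (firstInput (zstar x) - d)

/-- A run of the prediction-correction closed loop: the first input of the current iterate is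
applied, then one prediction and `N` corrections give the next iterate. -/
def IsRun (N : ℕ) (x : ℕ → State n) (z : ℕ → Var n p H) : Prop :=
  ∀ k, x (k + 1) = S.f (x k) (firstInput (z k)) ∧
    z (k + 1) = (S.correct (x (k + 1)))^[N] (S.predict (x k) (x (k + 1)) (z k))

/-- The trajectories of the prediction-correction closed loop with state increments at most
`B T_s` for some `B > 0` (which may differ from run to run), each paired with its sequence of errors `d(k) = u_MPC(k) - u(k)`. -/
def RunTrajectories (zstar : State n → Var n p H) (N : ℕ) (Ts : ℝ) :
    Set ((ℕ → State n) × (ℕ → Input p)) :=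
  {τ | ∃ z : ℕ → Var n p H, S.IsRun N τ.1 z ∧
    (∃ B : ℝ, 0 < B ∧ ∀ k, ‖τ.1 (k + 1) - τ.1 k‖ ≤ B * Ts) ∧
    ∀ k, τ.2 k = firstInput (zstar (τ.1 k)) - firstInput (z k)}

end System

/-- The trajectories along which, at every time, the solution of the receding horizon problem
lies in `𝒳 × 𝒰`. -/
def SolutionsIn {n p H : ℕ} (zstar : State n → Var n p H) (𝒳 : Set (StateSeq n H))
    (𝒰 : Set (InputSeq p H)) : Set ((ℕ → State n) × (ℕ → Input p)) :=
  {τ | ∀ k, states (zstar (τ.1 k)) ∈ 𝒳 ∧ inputs (zstar (τ.1 k)) ∈ 𝒰}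

end PCMPC

end

/-!
The optimal value `V` of the receding horizon problem is a Lyapunov function of the nominal closed
loop: `α₁ ‖x‖ ≤ V x ≤ α₂ ‖x‖`, and `V` drops by at least `α₁ ‖x‖` per step, because the tail of the
optimal inputs can be prolonged at no extra cost (`System.value_perturbed_zero_le`). The
argument uses no continuity of `V`, and the two parts of the theorem avoid it differently.

*Global part.* At every state `y`, the value is bounded by the cost of the optimal inputs of the
preceding state without their first entry, over the horizon shortened by one. This bound is
continuous in `y` and in the inputs, and it equals `V x - ℓ(x, u)` at the nominal successor of `x`.
As the solutions stay in compact sets, `V` decreases along the disturbed trajectories up to an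
error that is uniformly small with the disturbance (`System.exists_value_perturbed_le`), and
`lyapunov_bound` turns this into uniform stability and attractivity.

*Local part.* Here the undisturbed closed loop is uniformly asymptotically stable by the Lyapunov
function, and the perturbed map is uniformly continuous on a compact neighbourhood of the origin.
Over a block of fixed length a disturbed trajectory stays close to an undisturbed one, which has
contracted by the end of the block, so blocks can be concatenated (`isLocallyISS_of_lyapunov`).

In both parts the outcome is an `ε`-`δ` form of input-to-state stability, from which comparison
functions are assembled as series of ramps (`isISS_of_uniform`). Runs of the prediction-correction
scheme are trajectories of the perturbed system, whatever iterates the scheme produces.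
-/

namespace PCMPC

/-! ### Comparison functions built from series -/

section Comparison

/-- A superposition of the ramps `t ↦ min 1 (t / ρ n)` with heights `c n`. For summable
heights, the value is at least `c n` as soon as `t` exceeds the threshold `ρ n > 0`. -/
noncomputable def rampSum (c ρ : ℕ → ℝ≥0) (t : ℝ≥0) : ℝ≥0 := ∑' n, c n * min 1 (t / ρ n)

variable {c ρ : ℕ → ℝ≥0}

lemma summable_ramps (hc : Summable c) (ρ : ℕ → ℝ≥0) (t : ℝ≥0) :
    Summable fun n => c n * min 1 (t / ρ n) :=
  NNReal.summable_of_le (fun _ => mul_le_of_le_one_right' (min_le_left _ _)) hc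

lemma continuous_rampSum (hc : Summable c) (ρ : ℕ → ℝ≥0) : Continuous (rampSum c ρ) := by
  have h : Continuous fun t : ℝ≥0 => ((rampSum c ρ t : ℝ≥0) : ℝ) := by
    simp only [rampSum, NNReal.coe_tsum]
    refine continuous_tsum (u := fun n => (c n : ℝ)) (fun n => ?_) (NNReal.summable_coe.2 hc)
      fun n t => ?_
    · simp only [div_eq_mul_inv]
      fun_prop
    · rw [Real.norm_of_nonneg (NNReal.coe_nonneg _)]
      exact_mod_cast mul_le_of_le_one_right' (min_le_left _ _)
  exact continuous_induced_rng.2 h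

lemma monotone_rampSum (hc : Summable c) (ρ : ℕ → ℝ≥0) : Monotone (rampSum c ρ) := by
  intro s t hst
  refine (summable_ramps hc ρ s).tsum_le_tsum (fun n => ?_) (summable_ramps hc ρ t)
  gcongr

lemma le_rampSum (hc : Summable c) {n : ℕ} {t : ℝ≥0} (hρ : 0 < ρ n) (ht : ρ n < t) :
    c n ≤ rampSum c ρ t := by
  have h1 : min 1 (t / ρ n) = 1 := min_eq_left ((one_le_div hρ).2 ht.le)
  calc c n = c n * min 1 (t / ρ n) := by rw [h1, mul_one]
    _ ≤ rampSum c ρ t := (summable_ramps hc ρ t).le_tsum n fun _ _ => zero_le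

lemma isClassK_mul_add_rampSum {a : ℝ≥0} (ha : 0 < a) (hc : Summable c) (ρ : ℕ → ℝ≥0) :
    IsClassK fun t => t * a + rampSum c ρ t := by
  refine ⟨(continuous_id.mul continuous_const).add (continuous_rampSum hc ρ), ?_, ?_⟩
  · exact StrictMono.add_monotone (fun s t hst => mul_lt_mul_of_pos_right hst ha)
      (monotone_rampSum hc ρ)
  · simp [rampSum]

lemma isClassKL_rampSum (hc : Summable c) (ρ : ℕ → ℝ≥0) (N : ℕ → ℕ) :
    IsClassKL fun s k => s * 2⁻¹ ^ k + rampSum (fun n => if k < N n then c n else 0) ρ s := by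
  have hle : ∀ k n, (if k < N n then c n else 0) ≤ c n := fun k n => by
    split_ifs <;> simp
  have hck : ∀ k, Summable fun n => if k < N n then c n else 0 :=
    fun k => NNReal.summable_of_le (hle k) hc
  refine ⟨fun k => isClassK_mul_add_rampSum (by positivity) (hck k) ρ, fun s => ⟨?_, ?_⟩⟩
  · intro k l hkl
    refine add_le_add (mul_le_mul_right (pow_le_pow_of_le_one zero_le ?_ hkl) _)
      ((summable_ramps (hck l) ρ s).tsum_le_tsum (fun n => ?_) (summable_ramps (hck k) ρ s))
    · exact inv_le_one_of_one_le₀ (by norm_num)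
    · by_cases hl : l < N n
      · simp [hl, hkl.trans_lt hl]
      · simp [hl]
  · have h1 : Filter.Tendsto (fun k : ℕ => s * (2⁻¹ : ℝ≥0) ^ k) Filter.atTop (𝓝 0) := by
      have := (NNReal.tendsto_pow_atTop_nhds_zero_of_lt_one 
        (inv_lt_one_of_one_lt₀ one_lt_two)).const_mul s
      simpa using this
    have h2 : Filter.Tendsto
        (fun k : ℕ => rampSum (fun n => if k < N n then c n else 0) ρ s) Filter.atTop (𝓝 0) := by
      rw [← NNReal.tendsto_coe]
      simp only [rampSum, NNReal.coe_tsum]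
      -- Dominated convergence: every single term vanishes from the time `N n` on.
      have := tendsto_tsum_of_dominated_convergence (𝓕 := Filter.atTop)
        (f := fun (k n : ℕ) => (((if k < N n then c n else 0) * min 1 (s / ρ n) : ℝ≥0) : ℝ))
        (g := fun _ => (0 : ℝ)) (bound := fun n => (c n : ℝ)) (NNReal.summable_coe.2 hc)
        (fun n => tendsto_const_nhds.congr' <| by
          filter_upwards [Filter.eventually_ge_atTop (N n)] with k hk
          simp [not_lt.2 hk])
        (Filter.Eventually.of_forall fun k n => by
          rw [Real.norm_of_nonneg (NNReal.coe_nonneg _)]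
          exact_mod_cast (mul_le_of_le_one_right' (min_le_left _ _)).trans (hle k n))
      simpa using this
    simpa using h1.add h2

end Comparison

/-! ### Input-to-state stability from uniform estimates -/

section Uniform

variable {X W : Type*} [NormedAddCommGroup X] [NormedAddCommGroup W]

lemma IsISS.mono {T T' : Set ((ℕ → X) × (ℕ → W))} (h : IsISS T') (hT : T ⊆ T') : IsISS T := by
  obtain ⟨β, γ, hβ, hγ, hest⟩ := h
  exact ⟨β, γ, hβ, hγ, fun τ hτ => hest τ (hT hτ)⟩

lemma IsLocallyISS.mono {T T' : Set ((ℕ → X) × (ℕ → W))} (h : IsLocallyISS T') (hT : T ⊆ T') :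
    IsLocallyISS T := by
  obtain ⟨c₁, hc₁, c₂, hc₂, h⟩ := h
  exact ⟨c₁, hc₁, c₂, hc₂, h.mono fun τ hτ => ⟨hT hτ.1, hτ.2⟩⟩

/-- A uniformly bounded family is ISS as soon as, for every `ε`, sufficiently small disturbances
up to time `k` force `‖x k‖ ≤ ε`, provided the initial state is small or `k` is large. The gains
are superpositions of ramps whose thresholds are the constants belonging to a geometric sequence
of values of `ε`. -/
theorem isISS_of_uniform {T : Set ((ℕ → X) × (ℕ → W))} (R : ℝ≥0)
    (hR : ∀ τ ∈ T, ∀ k, ‖τ.1 k‖₊ ≤ R)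
    (hT : ∀ ε : ℝ≥0, 0 < ε → ∃ ρ > 0, ∃ δ > 0, ∃ N : ℕ, ∀ τ ∈ T, ∀ k,
      (∀ j < k, ‖τ.2 j‖₊ ≤ δ) → (‖τ.1 0‖₊ ≤ ρ ∨ N ≤ k) → ‖τ.1 k‖₊ ≤ ε) :
    IsISS T := by
  set e : ℕ → ℝ≥0 := fun n => (R + 1) * 2⁻¹ ^ n with he
  have he_pos : ∀ n, 0 < e n := fun n => by positivity
  have hhalf : (2⁻¹ : ℝ≥0) < 1 := inv_lt_one_of_one_lt₀ one_lt_two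
  have he_succ : ∀ n, 2 * e (n + 1) = e n := fun n => by
    simp only [he, pow_succ]
    rw [mul_comm, mul_assoc, mul_assoc, inv_mul_cancel₀ two_ne_zero, mul_one]
  have he_lim : Filter.Tendsto e Filter.atTop (𝓝 0) := by
    simpa only [mul_zero] using
      (NNReal.tendsto_pow_atTop_nhds_zero_of_lt_one hhalf).const_mul (R + 1)
  have hc : Summable fun n => 2 * e n :=
    ((NNReal.summable_geometric hhalf).mul_left (R + 1)).mul_left 2
  choose ρ hρ δ hδ N hN using fun n => hT (e n) (he_pos n)
  refine ⟨_, _, isClassKL_rampSum hc ρ N, isClassK_mul_add_rampSum one_pos hc δ, ?_⟩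
  intro τ hτ k
  rcases eq_or_ne ‖τ.1 k‖₊ 0 with h0 | h0
  · rw [h0]
    exact zero_le
  -- Locate `‖x k‖` between two consecutive terms of the geometric sequence.
  obtain ⟨n, hn, hn'⟩ : ∃ n, ‖τ.1 k‖₊ ≤ e n ∧ e (n + 1) < ‖τ.1 k‖₊ := by
    have hex : ∃ n, e n < ‖τ.1 k‖₊ :=
      (he_lim.eventually (gt_mem_nhds (pos_iff_ne_zero.2 h0))).exists
    classical
    have hfind : Nat.find hex ≠ 0 := fun h => by
      have h1 := Nat.find_spec hex
      rw [h] at h1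
      have h2 : R < e 0 := by simp [he]
      exact (h2.trans h1).not_ge (hR τ hτ k)
    obtain ⟨n, hn⟩ := Nat.exists_eq_succ_of_ne_zero hfind
    refine ⟨n, not_lt.1 (Nat.find_min hex (by omega)), ?_⟩
    have := Nat.find_spec hex
    rwa [hn] at this
  refine hn.trans ?_
  rw [← he_succ n]
  by_cases hd : ∀ j < k, ‖τ.2 j‖₊ ≤ δ (n + 1)
  · have hx : ¬(‖τ.1 0‖₊ ≤ ρ (n + 1) ∨ N (n + 1) ≤ k) := fun h =>
      (hN (n + 1) τ hτ k hd h).not_gt hn'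
    push Not at hx
    refine le_add_right (le_add_left ?_)
    have hck : Summable fun n => if k < N n then 2 * e n else 0 :=
      NNReal.summable_of_le (fun n => by split_ifs <;> simp) hc
    simpa [hx.2] using le_rampSum hck (hρ (n + 1)) hx.1
  · push Not at hd
    obtain ⟨j, hj, hd⟩ := hd
    refine le_add_left (le_add_left ?_)
    exact le_rampSum hc (hδ (n + 1))
      (hd.trans_le (Finset.le_sup (f := fun j => ‖τ.2 j‖₊) (Finset.mem_range.2 hj)))

end Uniform

/-! ### Lyapunov estimates -/

section Lyapunov

variable {X : Type*} [NormedAddCommGroup X]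

/-- If `v` decreases by `α₁ ‖x k‖` up to an error `η` in each step, then
`v k ≤ max c (v 0 - k a / 2)` for the level `c = α₁ ε` and a rate `a > 0` that depends only on
`ε`: above the level `c / 2` the decrease outweighs the error. -/
theorem lyapunov_bound {α₁ α₂ : ℝ≥0 → ℝ≥0} (h₁ : IsClassK α₁) (h₂ : IsClassK α₂) (R : ℝ≥0)
    {ε : ℝ≥0} (hε : 0 < ε) :
    ∃ ρ > (0 : ℝ≥0), ∃ η > (0 : ℝ), ∃ N : ℕ, ∀ (x : ℕ → X) (v : ℕ → ℝ) (K : ℕ),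
      (∀ k, (α₁ ‖x k‖₊ : ℝ) ≤ v k ∧ v k ≤ α₂ ‖x k‖₊) →
      (∀ k < K, v (k + 1) ≤ v k - α₁ ‖x k‖₊ + η) →
      (‖x 0‖₊ ≤ ρ ∨ ‖x 0‖₊ ≤ R ∧ N ≤ K) → ‖x K‖₊ ≤ ε := by
  have hpos : ∀ t, 0 < t → (0 : ℝ) < α₁ t := fun t ht => by
    have h3 := h₁.2.1 ht
    rw [h₁.2.2] at h3
    exact_mod_cast h3
  set c : ℝ := (α₁ ε : ℝ) with hcdef
  have hc' : 0 < c := hpos ε hε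
  obtain ⟨s, hs, hsc⟩ : ∃ s > (0 : ℝ≥0), (α₂ s : ℝ) < c / 2 := by
    have hlim : Filter.Tendsto (fun s => (α₂ s : ℝ)) (𝓝[>] 0) (𝓝 0) := by
      have : Filter.Tendsto (fun s => (α₂ s : ℝ)) (𝓝 0) (𝓝 (α₂ 0 : ℝ)) :=
        (NNReal.continuous_coe.comp h₂.1).tendsto 0
      rw [h₂.2.2] at this
      exact this.mono_left nhdsWithin_le_nhds
    obtain ⟨s, hs, hs'⟩ :=
      ((hlim.eventually (gt_mem_nhds (half_pos hc'))).and self_mem_nhdsWithin).exists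
    exact ⟨s, hs', hs⟩
  set a : ℝ := (α₁ s : ℝ) with hadef
  have ha : 0 < a := hpos s hs
  obtain ⟨N, hN⟩ := exists_nat_gt ((α₂ R : ℝ) / (a / 2))
  rw [div_lt_iff₀ (half_pos ha)] at hN
  refine ⟨s, hs, min (a / 2) (c / 2), lt_min (half_pos ha) (half_pos hc'), N, ?_⟩
  intro x v K hv hdec h0
  have hstep : ∀ k ≤ K, v k ≤ max c (v 0 - k * (a / 2)) := by
    intro k
    induction k with
    | zero => simp
    | succ k ih =>
      intro hk
      have ih := ih (by omega)
      have hd := hdec k (by omega)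
      have hη₁ := min_le_left (a / 2) (c / 2)
      have hη₂ := min_le_right (a / 2) (c / 2)
      have hα : (0 : ℝ) ≤ α₁ ‖x k‖₊ := NNReal.coe_nonneg _
      push_cast
      rcases le_or_gt (v k) (c / 2) with hsmall | hlarge
      · exact le_max_of_le_left (by linarith)
      · have hsx : s ≤ ‖x k‖₊ := by
          by_contra! hlt
          have h3 : (α₂ ‖x k‖₊ : ℝ) ≤ α₂ s := NNReal.coe_le_coe.2 (h₂.2.1.monotone hlt.le)
          linarith [(hv k).2]
        have hax : a ≤ α₁ ‖x k‖₊ := NNReal.coe_le_coe.2 (h₁.2.1.monotone hsx)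
        rcases le_max_iff.1 ih with h | h
        · exact le_max_of_le_left (by linarith)
        · exact le_max_of_le_right (by linarith)
  have hK : v K ≤ c := by
    refine (hstep K le_rfl).trans (max_le le_rfl ?_)
    have hv0 := (hv 0).2
    rcases h0 with h | ⟨h, hNK⟩
    · have h3 : (α₂ ‖x 0‖₊ : ℝ) ≤ α₂ s := NNReal.coe_le_coe.2 (h₂.2.1.monotone h)
      have : 0 ≤ (K : ℝ) * (a / 2) := by positivity
      linarith
    · have h3 : (α₂ ‖x 0‖₊ : ℝ) ≤ α₂ R := NNReal.coe_le_coe.2 (h₂.2.1.monotone h)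
      have : (N : ℝ) * (a / 2) ≤ K * (a / 2) := by gcongr
      linarith
  exact h₁.2.1.le_iff_le.1 (NNReal.coe_le_coe.1 ((hv K).1.trans (hK.trans_eq hcdef)))

end Lyapunov

/-! ### Robustness of asymptotic stability under small disturbances -/

section Robust

lemma Trajectories.shift {X W : Type*} {F : X → W → X} {τ : (ℕ → X) × (ℕ → W)} (hτ : τ ∈ Trajectories F)
    (T : ℕ) : ((fun k => τ.1 (T + k), fun k => τ.2 (T + k)) : (ℕ → X) × (ℕ → W)) ∈
      Trajectories F :=
  fun k => hτ (T + k)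

variable {X W : Type*} [NormedAddCommGroup X] [NormedAddCommGroup W]

/-- Over a fixed time span, trajectories with small disturbances stay close to the undisturbed
one, as long as the latter stays in a region where the right-hand side is uniformly continuous. -/
theorem exists_close_to_nominal {F : X → W → X} {r : ℝ} (hr : 0 < r)
    (hF : UniformContinuousOn (fun q : X × W => F q.1 q.2)
      (Metric.closedBall 0 r ×ˢ Metric.closedBall 0 r)) (T : ℕ) {η : ℝ} (hη : 0 < η) :
    ∃ δ > (0 : ℝ≥0), ∀ τ ∈ Trajectories F,
      (∀ k ≤ T, ‖(fun y => F y 0)^[k] (τ.1 0)‖ ≤ r / 2) →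
      ∀ k ≤ T, (∀ j < k, ‖τ.2 j‖₊ ≤ δ) → ‖τ.1 k - (fun y => F y 0)^[k] (τ.1 0)‖ ≤ η := by
  induction T generalizing η with
  | zero =>
    refine ⟨1, one_pos, fun τ _ _ k hk _ => ?_⟩
    obtain rfl : k = 0 := by omega
    simpa using hη.le
  | succ T ih =>
    obtain ⟨δ₁, hδ₁, hF'⟩ := Metric.uniformContinuousOn_iff.1 hF η hη
    have hη' : 0 < min η (min (δ₁ / 2) (r / 2)) := by positivity
    obtain ⟨δ₂, hδ₂, hclose⟩ := ih hη'
    refine ⟨min δ₂ (Real.toNNReal (min (δ₁ / 2) r)),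
      lt_min hδ₂ (Real.toNNReal_pos.2 (by positivity)), fun τ hτ hnom k hk hd => ?_⟩
    have hprev : ∀ k ≤ T, (∀ j < k, ‖τ.2 j‖₊ ≤ δ₂) → _ :=
      hclose τ hτ fun k hk => hnom k (by omega)
    rcases Nat.lt_or_ge T k with hTk | hTk
    · obtain rfl : k = T + 1 := by omega
      have hT := hprev T le_rfl fun j hj => (hd j (by omega)).trans (min_le_left _ _)
      have hdT : ‖τ.2 T‖ ≤ min (δ₁ / 2) r := by
        have h3 := (hd T (by omega)).trans (min_le_right _ _)
        rwa [← NNReal.coe_le_coe, coe_nnnorm, Real.coe_toNNReal _ (by positivity)] at h3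
      have hnT := hnom T (by omega)
      set y := (fun y => F y 0)^[T] (τ.1 0) with hy
      have hxT : ‖τ.1 T‖ ≤ r := by
        have h4 : ‖τ.1 T‖ ≤ ‖τ.1 T - y‖ + ‖y‖ := by simpa using norm_add_le (τ.1 T - y) y
        have h5 := hT.trans ((min_le_right _ _).trans (min_le_right _ _))
        linarith
      rw [Function.iterate_succ_apply', ← hy, hτ T, ← dist_eq_norm]
      refine (hF' (τ.1 T, τ.2 T) ⟨by simpa using hxT, by simpa using hdT.trans (min_le_right _ _)⟩
        (y, 0) ⟨by simpa using hnT.trans (by linarith), by simpa using hr.le⟩ ?_).le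
      rw [Prod.dist_eq, max_lt_iff]
      refine ⟨?_, ?_⟩
      · rw [dist_eq_norm]
        exact (hT.trans ((min_le_right _ _).trans (min_le_left _ _))).trans_lt (half_lt_self hδ₁)
      · rw [dist_zero_right]
        exact (hdT.trans (min_le_left _ _)).trans_lt (half_lt_self hδ₁)
    · exact (hprev k hTk fun j hj => (hd j hj).trans (min_le_left _ _)).trans (min_le_left _ _)

/-- A system that is continuous near the origin, and whose undisturbed part has a (possibly
discontinuous) Lyapunov function `V`, is locally ISS. Because `V` need not be continuous, it is
not evaluated along disturbed trajectories: these are compared with undisturbed ones over blocks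
of a fixed length `T`, after each of which the state is back in a small ball. -/
theorem isLocallyISS_of_lyapunov {F : X → W → X} {r : ℝ} (hr : 0 < r)
    (hF : UniformContinuousOn (fun q : X × W => F q.1 q.2)
      (Metric.closedBall 0 r ×ˢ Metric.closedBall 0 r))
    {α₁ α₂ : ℝ≥0 → ℝ≥0} (h₁ : IsClassK α₁) (h₂ : IsClassK α₂) {V : X → ℝ}
    (hV : ∀ x, (α₁ ‖x‖₊ : ℝ) ≤ V x ∧ V x ≤ α₂ ‖x‖₊)
    (hdec : ∀ x, V (F x 0) ≤ V x - α₁ ‖x‖₊) :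
    IsLocallyISS (Trajectories F) := by
  -- Uniform asymptotic stability of the undisturbed system.
  have hnom : ∀ (R ε : ℝ≥0), 0 < ε → ∃ ρ > (0 : ℝ≥0), ∃ N : ℕ, ∀ (x : X) (k : ℕ),
      (‖x‖₊ ≤ ρ ∨ ‖x‖₊ ≤ R ∧ N ≤ k) → ‖(fun y => F y 0)^[k] x‖₊ ≤ ε := by
    intro R ε hε
    obtain ⟨ρ, hρ, η, hη, N, h⟩ := lyapunov_bound (X := X) h₁ h₂ R hε
    refine ⟨ρ, hρ, N, fun x k hx => h (fun k => (fun y => F y 0)^[k] x)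
      (fun k => V ((fun y => F y 0)^[k] x)) k (fun k => hV _) (fun k _ => ?_) hx⟩
    simp only [Function.iterate_succ_apply']
    linarith [hdec ((fun y => F y 0)^[k] x)]
  have hr' : 0 < Real.toNNReal (r / 2) := Real.toNNReal_pos.2 (half_pos hr)
  -- Undisturbed trajectories from the ball of radius `r₁` stay in the ball of radius `r / 2`.
  obtain ⟨r₁, hr₁, _, hstay⟩ := hnom 0 _ hr'
  have hstay' : ∀ (x : X), ‖x‖₊ ≤ r₁ → ∀ k, ‖(fun y => F y 0)^[k] x‖ ≤ r / 2 := by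
    intro x hx k
    have h3 := hstay x k (Or.inl hx)
    rwa [← NNReal.coe_le_coe, coe_nnnorm, Real.coe_toNNReal _ (half_pos hr).le] at h3
  have hblock : ∀ ε : ℝ≥0, 0 < ε → ∃ ρ > (0 : ℝ≥0), ∃ δ > (0 : ℝ≥0), ∃ T : ℕ,
      ∀ τ ∈ Trajectories F, ‖τ.1 0‖₊ ≤ r₁ → ∀ k, (∀ j < k, ‖τ.2 j‖₊ ≤ δ) →
        ((‖τ.1 0‖₊ ≤ ρ ∨ T ≤ k) → ‖τ.1 k‖₊ ≤ ε) ∧ (k ≤ T → ‖τ.1 k‖ ≤ r) := by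
    intro ε hε
    obtain ⟨ρ₀, hρ₀, _, hρnom⟩ := hnom 0 (ε / 2) (half_pos hε)
    set ρ := min ρ₀ r₁ with hρdef
    have hρ : 0 < ρ := lt_min hρ₀ hr₁
    obtain ⟨_, _, T₀, hTnom⟩ := hnom r₁ (ρ / 2) (half_pos hρ)
    set T := T₀ + 1 with hTdef
    obtain ⟨δ, hδ, hclose⟩ := exists_close_to_nominal hr hF T
      (η := min (ρ / 2 : ℝ) (min (ε / 2 : ℝ) (r / 2))) (by positivity)
    have htri : ∀ (x y : X) (a b : ℝ), ‖x - y‖ ≤ a → ‖y‖ ≤ b → ‖x‖ ≤ a + b := by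
      intro x y a b hxy hy
      calc ‖x‖ = ‖x - y + y‖ := by rw [sub_add_cancel]
        _ ≤ a + b := norm_add_le_of_le hxy hy
    -- One block brings the state from the ball of radius `r₁` into the ball of radius `ρ`.
    have hend : ∀ τ ∈ Trajectories F, ‖τ.1 0‖₊ ≤ r₁ → (∀ j < T, ‖τ.2 j‖₊ ≤ δ) →
        ‖τ.1 T‖₊ ≤ ρ := by
      intro τ hτ h0 hd
      have h3 := hclose τ hτ (fun k _ => hstay' _ h0 k) T le_rfl hd
      have h4 : ‖(fun y => F y 0)^[T] (τ.1 0)‖ ≤ (ρ / 2 : ℝ) := by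
        exact_mod_cast hTnom (τ.1 0) T (Or.inr ⟨h0, by omega⟩)
      have h5 := htri _ _ _ _ (h3.trans (min_le_left _ _)) h4
      rw [← NNReal.coe_le_coe, coe_nnnorm]
      linarith
    have hsmall : ∀ (k : ℕ), ∀ τ ∈ Trajectories F, ‖τ.1 0‖₊ ≤ ρ → (∀ j < k, ‖τ.2 j‖₊ ≤ δ) →
        ‖τ.1 k‖₊ ≤ ε := by
      intro k
      induction k using Nat.strong_induction_on with
      | _ k ih =>
        intro τ hτ h0 hd
        have h0' : ‖τ.1 0‖₊ ≤ r₁ := h0.trans (min_le_right _ _)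
        rcases le_or_gt k T with hk | hk
        · have h3 := hclose τ hτ (fun k _ => hstay' _ h0' k) k hk hd
          have h4 : ‖(fun y => F y 0)^[k] (τ.1 0)‖ ≤ (ε / 2 : ℝ) := by
            exact_mod_cast hρnom (τ.1 0) k (Or.inl (h0.trans (min_le_left _ _)))
          have h5 := htri _ _ _ _ (h3.trans ((min_le_right _ _).trans (min_le_left _ _))) h4
          rw [← NNReal.coe_le_coe, coe_nnnorm]
          linarith
        · have h3 := ih (k - T) (by omega) _ (Trajectories.shift hτ T)
            (hend τ hτ h0' fun j hj => hd j (by omega)) fun j hj => hd (T + j) (by omega)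
          simpa only [Nat.add_sub_cancel' hk.le] using h3
    refine ⟨ρ, hρ, δ, hδ, T, fun τ hτ h0 k hd => ⟨?_, fun hk => ?_⟩⟩
    · rintro (h | h)
      · exact hsmall k τ hτ h hd
      · have h3 := hsmall (k - T) _ (Trajectories.shift hτ T)
          (hend τ hτ h0 fun j hj => hd j (by omega)) fun j hj => hd (T + j) (by omega)
        simpa only [Nat.add_sub_cancel' h] using h3
    · have h3 := hclose τ hτ (fun k _ => hstay' _ h0 k) k hk hd
      have h5 := htri _ _ _ _ (h3.trans ((min_le_right _ _).trans (min_le_right _ _)))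
        (hstay' _ h0 k)
      linarith
  obtain ⟨_, _, c₂, hc₂, T, hbdd⟩ := hblock (Real.toNNReal r) (Real.toNNReal_pos.2 hr)
  refine ⟨r₁, hr₁, c₂, hc₂, isISS_of_uniform (Real.toNNReal r) ?_ fun ε hε => ?_⟩
  · rintro τ ⟨hτ, h0, hd⟩ k
    have h3 := hbdd τ hτ h0 k fun j _ => hd j
    rcases le_total k T with hk | hk
    · rw [← NNReal.coe_le_coe, coe_nnnorm, Real.coe_toNNReal _ hr.le]
      exact h3.2 hk
    · exact h3.1 (Or.inr hk)
  · obtain ⟨ρ, hρ, δ, hδ, T, h⟩ := hblock ε hε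
    exact ⟨ρ, hρ, δ, hδ, T, fun τ hτ k hd => (h τ hτ.1 hτ.2.1 k hd).1⟩

end Robust

/-! ### The value function of the receding horizon problem -/

namespace System

variable {n p : ℕ} (S : System n p)

/-- The cost of applying the inputs `us` from the initial state `x` on, with the states
eliminated. -/
def rolloutCost : (h : ℕ) → State n → (Fin h → Input p) → ℝ
  | 0, x, _ => S.terminal x
  | h + 1, x, us => S.stage x (us 0) + rolloutCost h (S.f x (us 0)) (Fin.tail us)

lemma continuous_rolloutCost (hS : S.ContinuityAssumption) (h : ℕ) :
    Continuous fun q : State n × (Fin h → Input p) => S.rolloutCost h q.1 q.2 := by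
  obtain ⟨hf, hl, ht, -⟩ := hS
  induction h with
  | zero => exact ht.comp continuous_fst
  | succ h ih =>
    have h1 : Continuous fun q : State n × (Fin (h + 1) → Input p) => (q.1, q.2 0) := by fun_prop
    have h2 : Continuous fun q : State n × (Fin (h + 1) → Input p) => Fin.tail q.2 := by
      unfold Fin.tail
      fun_prop
    exact (hl.comp h1).add (ih.comp ((hf.comp h1).prodMk h2))

lemma rolloutCost_nonneg (hS : S.ContinuityAssumption) (h : ℕ) (x : State n)
    (us : Fin h → Input p) : 0 ≤ S.rolloutCost h x us := by
  induction h generalizing x with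
  | zero => exact hS.2.2.2.2.1 x
  | succ h ih => exact add_nonneg (hS.2.2.2.1 _ _) (ih _ _)

lemma Feasible.cost_eq {S : System n p} {h : ℕ} {x : State n} {xs : StateSeq n h}
    {us : InputSeq p h} (hfeas : S.Feasible x xs us) :
    S.cost xs us = S.rolloutCost h x us.ofLp := by
  induction h generalizing x with
  | zero =>
    have := hfeas.1
    simp only [cost, rolloutCost, Finset.univ_eq_empty, Finset.sum_empty, zero_add]
    rw [← this]
    rfl
  | succ h ih =>
    obtain ⟨h0, hstep⟩ := hfeas
    have htail : S.Feasible (S.f x (us 0)) (WithLp.toLp 2 fun i => xs i.succ)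
        (WithLp.toLp 2 fun i => us i.succ) := by
      refine ⟨?_, fun i => hstep i.succ⟩
      have h3 := hstep 0
      rw [Fin.castSucc_zero, h0] at h3
      exact h3
    have h4 := ih htail
    rw [cost] at h4 ⊢
    rw [Fin.sum_univ_succ, Fin.castSucc_zero, h0, add_assoc, rolloutCost]
    exact congrArg (S.stage x (us 0) + ·) h4

lemma exists_feasible (h : ℕ) (x : State n) (us : InputSeq p h) :
    ∃ xs : StateSeq n h, S.Feasible x xs us := by
  let y : ℕ → State n := fun k =>
    Nat.rec x (fun i yi => if hi : i < h then S.f yi (us ⟨i, hi⟩) else yi) k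
  refine ⟨WithLp.toLp 2 fun i => y i, rfl, fun i => ?_⟩
  change (if hi : (i : ℕ) < h then S.f (y i) (us ⟨i, hi⟩) else y i) = S.f (y i) (us i)
  simp

lemma IsOptimal.rolloutCost_le {S : System n p} {h : ℕ} {x : State n} {xs : StateSeq n h}
    {us : InputSeq p h} (hopt : S.IsOptimal x xs us) (us' : Fin h → Input p) :
    S.rolloutCost h x us.ofLp ≤ S.rolloutCost h x us' := by
  obtain ⟨xs', hfeas⟩ := S.exists_feasible h x (WithLp.toLp 2 us')
  have h3 := hopt.2 _ _ hfeas
  rwa [hopt.1.cost_eq, hfeas.cost_eq] at h3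

/-- Prolonging the horizon does not increase the optimal cost: append an input for which the
terminal cost decreases by the stage cost. -/
lemma CostAssumption.exists_rolloutCost_succ_le {S : System n p} (hS : S.CostAssumption) (h : ℕ)
    (x : State n) (us : Fin h → Input p) :
    ∃ us' : Fin (h + 1) → Input p, S.rolloutCost (h + 1) x us' ≤ S.rolloutCost h x us := by
  induction h generalizing x with
  | zero =>
    obtain ⟨u, hu⟩ := hS.2 x
    refine ⟨fun _ => u, ?_⟩
    simp only [rolloutCost]
    linarith
  | succ h ih =>
    obtain ⟨us', hus'⟩ := ih (S.f x (us 0)) (Fin.tail us)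
    refine ⟨Fin.cons (us 0) us', ?_⟩
    rw [rolloutCost, rolloutCost, Fin.cons_zero, Fin.tail_cons]
    exact add_le_add_right hus' _

lemma CostAssumption.exists_rolloutCost_le_terminal {S : System n p} (hS : S.CostAssumption)
    (h : ℕ) (x : State n) : ∃ us : Fin h → Input p, S.rolloutCost h x us ≤ S.terminal x := by
  induction h with
  | zero => exact ⟨Fin.elim0, le_rfl⟩
  | succ h ih =>
    obtain ⟨us, hus⟩ := ih
    obtain ⟨us', hus'⟩ := hS.exists_rolloutCost_succ_le h x us
    exact ⟨us', hus'.trans hus⟩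

/-- The optimal value of the receding horizon problem, for the solution selected by `zstar`. -/
def value {h : ℕ} (zstar : State n → Var n p h) (x : State n) : ℝ :=
  S.rolloutCost h x (inputs (zstar x)).ofLp

variable {S}

lemma value_le_terminal {h : ℕ} {zstar : State n → Var n p h} (hz : S.IsSolutionMap zstar)
    (hS : S.CostAssumption) (x : State n) : S.value zstar x ≤ S.terminal x := by
  obtain ⟨us, hus⟩ := hS.exists_rolloutCost_le_terminal h x
  exact ((hz x).1.rolloutCost_le us).trans hus

lemma stage_le_value {h : ℕ} {zstar : State n → Var n p (h + 1)} (hS : S.ContinuityAssumption)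
    (x : State n) : S.stage x (inputs (zstar x) 0) ≤ S.value zstar x :=
  le_add_of_nonneg_right (S.rolloutCost_nonneg hS _ _ _)

/-- The tail of the optimal inputs at `x`, over the horizon shortened by one, bounds the value at
every state `y`. In contrast to the value function itself, this bound is continuous in `y`. -/
lemma value_le_rolloutCost_tail {h : ℕ} {zstar : State n → Var n p (h + 1)}
    (hz : S.IsSolutionMap zstar) (hS : S.CostAssumption) (y : State n) (us : Fin h → Input p) :
    S.value zstar y ≤ S.rolloutCost h y us := by
  obtain ⟨us', hus'⟩ := hS.exists_rolloutCost_succ_le h y us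
  exact ((hz y).1.rolloutCost_le us').trans hus'

lemma value_perturbed_zero_le {h : ℕ} {zstar : State n → Var n p (h + 1)}
    (hz : S.IsSolutionMap zstar) (hS : S.CostAssumption) (x : State n) :
    S.value zstar (S.perturbed zstar x 0) ≤
      S.value zstar x - S.stage x (inputs (zstar x) 0) := by
  have h3 := value_le_rolloutCost_tail hz hS (S.perturbed zstar x 0)
    (Fin.tail (inputs (zstar x)).ofLp)
  have h4 : S.value zstar x = S.stage x (inputs (zstar x) 0) +
      S.rolloutCost h (S.perturbed zstar x 0) (Fin.tail (inputs (zstar x)).ofLp) := by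
    rw [perturbed, sub_zero]
    rfl
  linarith

/-- The value decreases along the perturbed closed loop up to an error that is small with the
disturbance, uniformly over the states whose solution lies in given compact sets. -/
lemma exists_value_perturbed_le {h : ℕ} {zstar : State n → Var n p (h + 1)}
    (hz : S.IsSolutionMap zstar) (hcont : S.ContinuityAssumption) (hS : S.CostAssumption)
    {𝒳 : Set (StateSeq n (h + 1))} (h𝒳 : IsCompact 𝒳) {𝒰 : Set (InputSeq p (h + 1))}
    (h𝒰 : IsCompact 𝒰) {η : ℝ} (hη : 0 < η) :
    ∃ δ > (0 : ℝ≥0), ∀ (x : State n) (d : Input p), states (zstar x) ∈ 𝒳 →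
      inputs (zstar x) ∈ 𝒰 → ‖d‖₊ ≤ δ →
      S.value zstar (S.perturbed zstar x d) ≤
        S.value zstar x - S.stage x (inputs (zstar x) 0) + η := by
  let G : (StateSeq n (h + 1) × InputSeq p (h + 1)) × Input p → ℝ := fun q =>
    S.rolloutCost h (S.f (q.1.1 0) (q.1.2 0 - q.2)) (Fin.tail q.1.2.ofLp)
  have hG : Continuous G := by
    have h1 : Continuous fun q : (StateSeq n (h + 1) × InputSeq p (h + 1)) × Input p =>
        (q.1.1 0, q.1.2 0 - q.2) := by fun_prop
    have h2 : Continuous fun q : (StateSeq n (h + 1) × InputSeq p (h + 1)) × Input p =>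
        Fin.tail q.1.2.ofLp := by
      unfold Fin.tail
      fun_prop
    exact (S.continuous_rolloutCost hcont h).comp ((hcont.1.comp h1).prodMk h2)
  have hK : IsCompact ((𝒳 ×ˢ 𝒰) ×ˢ Metric.closedBall (0 : Input p) 1) :=
    (h𝒳.prod h𝒰).prod (isCompact_closedBall 0 1)
  obtain ⟨δ, hδ, hG'⟩ := Metric.uniformContinuousOn_iff.1
    (hK.uniformContinuousOn_of_continuous hG.continuousOn) η hη
  refine ⟨min 1 (Real.toNNReal (δ / 2)),
    lt_min one_pos (Real.toNNReal_pos.2 (half_pos hδ)), fun x d hx hu hd => ?_⟩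
  have hd1 : ‖d‖ ≤ 1 := hd.trans (min_le_left _ _)
  have hd2 : ‖d‖ ≤ δ / 2 := by
    have h3 := hd.trans (min_le_right _ _)
    rwa [← NNReal.coe_le_coe, coe_nnnorm, Real.coe_toNNReal _ (half_pos hδ).le] at h3
  have hx0 : states (zstar x) 0 = x := (hz x).1.1.1
  have h3 := hG' ((states (zstar x), inputs (zstar x)), d) ⟨⟨hx, hu⟩, by simpa using hd1⟩
    ((states (zstar x), inputs (zstar x)), 0) ⟨⟨hx, hu⟩, by simp⟩ (by
      rw [Prod.dist_eq, dist_self, dist_zero_right]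
      exact max_lt hδ (hd2.trans_lt (half_lt_self hδ)))
  have h4 := (abs_lt.1 (Real.dist_eq _ _ ▸ h3)).2
  simp only [G, hx0, sub_zero] at h4
  have h5 := value_le_rolloutCost_tail hz hS (S.perturbed zstar x d)
    (Fin.tail (inputs (zstar x)).ofLp)
  have h6 : S.value zstar x = S.stage x (inputs (zstar x) 0) +
      S.rolloutCost h (S.f x (inputs (zstar x) 0)) (Fin.tail (inputs (zstar x)).ofLp) := rfl
  have h7 : S.perturbed zstar x d = S.f x (inputs (zstar x) 0 - d) := rfl
  rw [h7] at h5 ⊢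
  linarith

/-! ### Stability of the closed loop -/

theorem isISS_perturbed {h : ℕ} {zstar : State n → Var n p (h + 1)}
    (hz : S.IsSolutionMap zstar) (hcont : S.ContinuityAssumption) (hS : S.CostAssumption)
    {𝒳 : Set (StateSeq n (h + 1))} (h𝒳 : IsCompact 𝒳) {𝒰 : Set (InputSeq p (h + 1))}
    (h𝒰 : IsCompact 𝒰) :
    IsISS (Trajectories (S.perturbed zstar) ∩ SolutionsIn zstar 𝒳 𝒰) := by
  obtain ⟨⟨α₁, α₂, h₁, h₂, hstage, hterm⟩, -⟩ := id hS
  obtain ⟨R, hR⟩ := (h𝒳.image (f := fun xs : StateSeq n (h + 1) => xs 0)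
    (by fun_prop)).isBounded.exists_norm_le
  -- The first predicted state is the current state, so the states are confined to a ball.
  have hbdd : ∀ τ ∈ Trajectories (S.perturbed zstar) ∩ SolutionsIn zstar 𝒳 𝒰, ∀ k,
      ‖τ.1 k‖₊ ≤ Real.toNNReal R := by
    rintro τ ⟨-, hτ⟩ k
    have h3 := hR _ ⟨_, (hτ k).1, (hz (τ.1 k)).1.1.1⟩
    exact NNReal.le_toNNReal_of_coe_le h3
  refine isISS_of_uniform (Real.toNNReal R) hbdd fun ε hε => ?_
  obtain ⟨ρ, hρ, η, hη, N, hbound⟩ :=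
    lyapunov_bound (X := State n) h₁.1 h₂.1 (Real.toNNReal R) hε
  obtain ⟨δ, hδ, hval⟩ := exists_value_perturbed_le hz hcont hS h𝒳 h𝒰 hη
  refine ⟨ρ, hρ, δ, hδ, N, fun τ hτ k hd hk => ?_⟩
  refine hbound τ.1 (fun j => S.value zstar (τ.1 j)) k (fun j => ⟨?_, ?_⟩) (fun j hj => ?_)
    (hk.imp_right fun h => ⟨hbdd τ hτ 0, h⟩)
  · exact (hstage _ _).trans (stage_le_value hcont _)
  · exact (value_le_terminal hz hS _).trans (hterm _)
  · have h3 := hval (τ.1 j) (τ.2 j) (hτ.2 j).1 (hτ.2 j).2 (hd j hj)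
    rw [← hτ.1 j] at h3
    linarith [hstage (τ.1 j) (inputs (zstar (τ.1 j)) 0)]

theorem isLocallyISS_perturbed {h : ℕ} {zstar : State n → Var n p (h + 1)}
    (hz : S.IsSolutionMap zstar) (hcont : S.ContinuityAssumption) (hS : S.CostAssumption)
    {U : Set (State n × Input p)} (hU : U ∈ 𝓝 ((0 : State n), (0 : Input p)))
    (hF : ContinuousOn (fun q : State n × Input p => S.perturbed zstar q.1 q.2) U) :
    IsLocallyISS (Trajectories (S.perturbed zstar)) := by
  obtain ⟨⟨α₁, α₂, h₁, h₂, hstage, hterm⟩, -⟩ := id hS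
  obtain ⟨r, hr, hrU⟩ := Metric.nhds_basis_closedBall.mem_iff.1 hU
  rw [← closedBall_prod_same] at hrU
  refine isLocallyISS_of_lyapunov hr
    (((isCompact_closedBall 0 r).prod (isCompact_closedBall 0 r)).uniformContinuousOn_of_continuous
      (hF.mono hrU)) h₁.1 h₂.1 (V := S.value zstar) (fun x => ⟨?_, ?_⟩) fun x => ?_
  · exact (hstage _ _).trans (stage_le_value hcont _)
  · exact (value_le_terminal hz hS _).trans (hterm _)
  · linarith [value_perturbed_zero_le hz hS x, hstage x (inputs (zstar x) 0)]

/-- Whatever the prediction and correction steps produce, a run is a trajectory of the perturbed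
system, by the definition of the solution error. -/
lemma runTrajectories_subset {H : ℕ} [NeZero H] (zstar : State n → Var n p H) (N : ℕ) (Ts : ℝ) :
    S.RunTrajectories zstar N Ts ⊆ Trajectories (S.perturbed zstar) := by
  rintro τ ⟨z, hrun, -, hd⟩ k
  rw [perturbed, hd k, sub_sub_cancel]
  exact (hrun k).1

end System

end PCMPC

theorem mainTheorem5 {n p H : ℕ} [NeZero H] (S : PCMPC.System n p)
    (zstar : PCMPC.State n → PCMPC.Var n p H) (hz : S.IsSolutionMap zstar)
    (h_cont : S.ContinuityAssumption)
    (𝒳 : Set (PCMPC.StateSeq n H)) (h𝒳 : IsCompact 𝒳)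
    (𝒰 : Set (PCMPC.InputSeq p H)) (h𝒰 : IsCompact 𝒰)
    (h_cost : S.CostAssumption)
    (Ts : ℝ) (hTs : 0 < Ts)
    (m : ℝ) (h_eig : S.EigenvalueAssumption zstar m)
    (C L : ℝ) (h_smooth : S.SmoothnessAssumption H C L) :
    -- For each fixed state the perturbed map is uniformly continuous in `d` on bounded sets, and the
    -- nominal map in `x`; this is weaker than absolute continuity.
    ((∀ x r, UniformContinuousOn (fun d => S.perturbed zstar x d) (Metric.closedBall 0 r)) →
      (∀ r, UniformContinuousOn (fun x => S.nominal zstar x) (Metric.closedBall 0 r)) →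
        PCMPC.IsISS (PCMPC.Trajectories (S.perturbed zstar) ∩ PCMPC.SolutionsIn zstar 𝒳 𝒰) ∧
        ∀ N : ℕ, PCMPC.IsISS
          (S.RunTrajectories zstar N Ts ∩ PCMPC.SolutionsIn zstar 𝒳 𝒰)) ∧
    -- Local version.
    ((∃ V ∈ 𝓝 ((0 : PCMPC.State n), (0 : PCMPC.Input p)),
        ContinuousOn (fun q : PCMPC.State n × PCMPC.Input p => S.perturbed zstar q.1 q.2) V) →
      (∃ V ∈ 𝓝 (0 : PCMPC.State n), ContinuousOn (fun x => S.nominal zstar x) V) →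
        PCMPC.IsLocallyISS (PCMPC.Trajectories (S.perturbed zstar)) ∧
        ∀ N : ℕ, PCMPC.IsLocallyISS (S.RunTrajectories zstar N Ts)) := by
  obtain ⟨h, rfl⟩ := Nat.exists_eq_succ_of_ne_zero (NeZero.ne H)
  refine ⟨fun _ _ => ?_, fun ⟨U, hU, hF⟩ _ => ?_⟩
  · have hISS := PCMPC.System.isISS_perturbed hz h_cont h_cost h𝒳 h𝒰
    exact ⟨hISS, fun N => hISS.mono
      (Set.inter_subset_inter_left _ (PCMPC.System.runTrajectories_subset zstar N Ts))⟩
  · have hISS := PCMPC.System.isLocallyISS_perturbed hz h_cont h_cost hU hF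
    exact ⟨hISS, fun N => hISS.mono (PCMPC.System.runTrajectories_subset zstar N Ts)⟩
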